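/- Let $a,T,D\in\mathbb R$ with $a\neq 0$, and consider the planar linear system $$\dot x = Tx-y,\qquad \dot y = Dx-a .$$ Its left Poincaré half-map $P:I\subset[0,+\infty)\to(-\infty,0]$ associated with the section $\{x=0\}$ is defined as follows. For $y_0\ge 0$ let $\Phi(t;y_0)=(\Phi_1(t;y_0),\Phi_2(t;y_0))$ be the solution with $\Phi(0;y_0)=(0,y_0)$; if there is $\tau>0$ with $\Phi_1(\tau;y_0)=0$ and $\Phi_1(t;y_0)<0$ for all $t\in(0,\tau)$, then $y_0\in I$ and $P(y_0)=\Phi_2(\tau;y_0)$. If $y_0=0$ admits no such $\tau$, but for every $\varepsilon>0$ there is $y_0\in(0,\varepsilon)$ for which $P(y_0)$ is defined as above and lies in $(-\varepsilon,0)$, then $0\in I$ and $P(0)=0$. No other points belong to $I$. Put $W(y)=Dy^2-aTy+a^2$ and let $\mathcal I$ be the connected component of $\{y\in\mathbb R: W(y)>0\}$ that contains $0$. Assume that $0\in I$ and $P(0)=0$. Then: (1) $P$ is real analytic on $I$ (one-sidedly at the endpoint $0$ of $I$); (2) $P$ is an involution, in the following sense: $I=\mathcal I\cap[0,+\infty)$,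 and $P$ is the restriction to $I$ of a real analytic function $\varphi:\mathcal I\to\mathcal I$ such that $\varphi(\varphi(y))=y$ for all $y\in\mathcal I$; (3) as $y_0\to 0^+$, $$\begin{aligned}P(y_0)={}&-y_0-\frac{2Ty_0^2}{3a}-\frac{4T^2y_0^3}{9a^2}+\frac{2(9DT-22T^3)y_0^4}{135a^3}+\frac{4(27DT^2-26T^4)y_0^5}{405a^4}\\&-\frac{2(27D^2T-176DT^3+100T^5)y_0^6}{945a^5}+\mathcal O(y_0^7).\end{aligned}$$ -/

import Mathlib

open Set Filter Topology Asymptotics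

/-- The vector field of the planar linear system in generalized Liénard form
`x' = T x - y`, `y' = D x - a`; a point is a pair `(x, y)`. -/
def lienardField (a T D : ℝ) (p : ℝ × ℝ) : ℝ × ℝ := (T * p.1 - p.2, D * p.1 - a)

/-- `Φ` is a (global) solution of the system. -/
def IsLienardSolution (a T D : ℝ) (Φ : ℝ → ℝ × ℝ) : Prop :=
  ∀ t, HasDerivAt Φ (lienardField a T D (Φ t)) t

/-- The orbit of `(0, y₀)` runs through the open half-plane `x < 0` and comes back to the section
`x = 0` for the first time at the point `(0, y₁)`. -/
def IsLeftReturn (a T D y₀ y₁ : ℝ) : Prop :=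
  ∃ Φ : ℝ → ℝ × ℝ, IsLienardSolution a T D Φ ∧ Φ 0 = (0, y₀) ∧
    ∃ τ : ℝ, 0 < τ ∧ Φ τ = (0, y₁) ∧ ∀ t ∈ Ioo 0 τ, (Φ t).1 < 0

/-- The graph of the left Poincaré half-map. A point `y₀ ≥ 0` is sent to the ordinate of the first
return through `x < 0`; if the orbit of the origin has no such return, the map is extended by
`0 ↦ 0` provided that there are pairs `(y₀, y₁)`, `y₁ < 0 < y₀`, in its graph arbitrarily close to
`(0, 0)`. -/
def LeftHalfMapGraph (a T D y₀ y₁ : ℝ) : Prop :=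
  (0 ≤ y₀ ∧ IsLeftReturn a T D y₀ y₁) ∨
  (y₀ = 0 ∧ y₁ = 0 ∧ (¬ ∃ z, IsLeftReturn a T D 0 z) ∧
    ∀ ε > 0, ∃ z₀ ∈ Ioo 0 ε, ∃ z₁ ∈ Ioo (-ε) 0, IsLeftReturn a T D z₀ z₁)

theorem IsLienardSolution.unique {a T D : ℝ} {Φ Ψ : ℝ → ℝ × ℝ} (hΦ : IsLienardSolution a T D Φ)
    (hΨ : IsLienardSolution a T D Ψ) (h : Φ 0 = Ψ 0) : Φ = Ψ := by
  let L : ℝ × ℝ →L[ℝ] ℝ × ℝ :=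
    (T • ContinuousLinearMap.fst ℝ ℝ ℝ - ContinuousLinearMap.snd ℝ ℝ ℝ).prod
      (D • ContinuousLinearMap.fst ℝ ℝ ℝ)
  have hv : ∀ p, lienardField a T D p = L p - ((0 : ℝ), a) := by
    intro p
    simp [lienardField, L]
  have hlip : LipschitzWith ‖L‖₊ (lienardField a T D) := by
    refine LipschitzWith.of_dist_le_mul fun p q => ?_
    rw [hv, hv, dist_sub_right]
    exact L.lipschitz.dist_le_mul p q
  exact ODE_solution_unique_univ (v := fun _ => lienardField a T D) (s := fun _ => univ)
    (t₀ := 0) (fun _ => hlip.lipschitzOnWith) (fun t => ⟨hΦ t, mem_univ _⟩)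
    (fun t => ⟨hΨ t, mem_univ _⟩) h

theorem IsLeftReturn.unique {a T D y₀ y₁ z₁ : ℝ} (h : IsLeftReturn a T D y₀ y₁)
    (h' : IsLeftReturn a T D y₀ z₁) : y₁ = z₁ := by
  obtain ⟨Φ, hΦ, h0, τ, hτ, h1, hneg⟩ := h
  obtain ⟨Ψ, hΨ, k0, σ, hσ, k1, kneg⟩ := h'
  obtain rfl := hΦ.unique hΨ (h0.trans k0.symm)
  rcases lt_trichotomy τ σ with hlt | rfl | hlt
  · simpa [h1] using kneg τ ⟨hτ, hlt⟩
  · simpa using h1.symm.trans k1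
  · simpa [k1] using hneg σ ⟨hσ, hlt⟩

/-- The left Poincaré half-map is well defined: its graph is the graph of a function. -/
theorem LeftHalfMapGraph.unique {a T D y₀ y₁ z₁ : ℝ} (h : LeftHalfMapGraph a T D y₀ y₁)
    (h' : LeftHalfMapGraph a T D y₀ z₁) : y₁ = z₁ := by
  rcases h with ⟨-, h⟩ | ⟨rfl, rfl, hn, -⟩ <;> rcases h' with ⟨-, h'⟩ | ⟨h0, rfl, hn', -⟩
  · exact h.unique h'
  · exact absurd ⟨_, h0 ▸ h⟩ hn'
  · exact absurd ⟨_, h'⟩ hn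
  · rfl

/-- The domain of definition `I` of the left Poincaré half-map. -/
def leftDomain (a T D : ℝ) : Set ℝ := {y₀ | ∃ y₁, LeftHalfMapGraph a T D y₀ y₁}

open Classical in
/-- The left Poincaré half-map `P` (with the irrelevant value `0` outside of its domain `I`). -/
noncomputable def leftHalfMap (a T D y₀ : ℝ) : ℝ :=
  if h : ∃ y₁, LeftHalfMapGraph a T D y₀ y₁ then h.choose else 0

/-- The quadratic polynomial `W(y) = D y² - a T y + a²`. -/
def lienardW (a T D y : ℝ) : ℝ := D * y ^ 2 - a * T * y + a ^ 2

/-- The largest interval around `0` on which `W` is positive (for `a ≠ 0`). -/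
def positivityInterval (a T D : ℝ) : Set ℝ := connectedComponentIn {y | 0 < lienardW a T D y} 0

/-! For `a > 0` the half-map is parametrized by the flight time. The orbit of `(0, y₀)` has abscissa
`a g - y₀ s`, so where `s ≠ 0` it meets the section at time `t` exactly when `y₀ = Y(t)`, with `Y =
a g / s` (`crossing`). The Wronskian-type identity `wronskian` shows that the return ordinate is
`Y(-t)`. On the symmetric interval `J` of times before the first zero of `s`, `Y` is analytic (the
singularity at `0` is removable) with positive derivative, and `Y(J)` is the positivity interval of
`W` (`image_crossing`). Hence `P` is the restriction to `Y ≥ 0` of `φ = Y ∘ (-·) ∘ Y⁻¹`, which is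
visibly an analytic involution.

For the expansion, `φ` satisfies `φ φ' W(y) = y W(φ)` (`crossingInvolution_ode`). With `φ(0) = 0`
and `φ'(0) = -1` this determines all Taylor coefficients at `0`, so it is enough that the proposed
polynomial solves the equation up to `O(y⁷)`.

For `a < 0` orbits starting near the origin with `y₀ ≥ 0` take a time bounded below to return. A
return multiplies `W` by `exp (T τ)`, while `W → a²` at both ends as they tend to `0`; this forces
`T = 0`. Monotonicity of `y` then excludes `D ≤ 0`, so the system is a center and `P(y) = -y`. -/

/-! ### Fundamental solution and time reversal. -/

/-- `g` is the primitive vanishing at `0` of the fundamental solution `s` of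
`s'' - T s' + D s = 0`, `s 0 = 0`, `s' 0 = 1`. -/
structure IsFundamental (T D : ℝ) (g s : ℝ → ℝ) : Prop where
  hg : ∀ t, HasDerivAt g (s t) t
  hs : ∀ t, HasDerivAt s (1 + T * s t - D * g t) t
  g0 : g 0 = 0
  s0 : s 0 = 0
  ag : ∀ t, AnalyticAt ℝ g t

/-- The constant `1` is added as a third coordinate, which makes the system for `(g, s)`
homogeneous; the matrix exponential then gives global existence and analyticity together. -/
theorem exists_isFundamental (T D : ℝ) : ∃ g s, IsFundamental T D g s := by
  let p₁ : ℝ × ℝ × ℝ →L[ℝ] ℝ := ContinuousLinearMap.fst ℝ ℝ (ℝ × ℝ)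
  let p₂ : ℝ × ℝ × ℝ →L[ℝ] ℝ :=
    (ContinuousLinearMap.fst ℝ ℝ ℝ).comp (ContinuousLinearMap.snd ℝ ℝ (ℝ × ℝ))
  let p₃ : ℝ × ℝ × ℝ →L[ℝ] ℝ :=
    (ContinuousLinearMap.snd ℝ ℝ ℝ).comp (ContinuousLinearMap.snd ℝ ℝ (ℝ × ℝ))
  let A : ℝ × ℝ × ℝ →L[ℝ] ℝ × ℝ × ℝ := p₂.prod ((p₃ + T • p₂ - D • p₁).prod 0)
  let v : ℝ × ℝ × ℝ := (0, 0, 1)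
  let F : ℝ → ℝ × ℝ × ℝ := fun t => NormedSpace.exp (t • A) v
  have hF : ∀ t, HasDerivAt F (A (F t)) t := fun t =>
    (hasDerivAt_exp_smul_const' (𝕂 := ℝ) A t).clm_apply (hasDerivAt_const t v) |>.congr_deriv
      (by simp [F])
  have hF0 : F 0 = v := by simp [F]
  have h1 : ∀ t, HasDerivAt (fun t => p₁ (F t)) (p₂ (F t)) t := fun t =>
    (p₁.hasFDerivAt.comp_hasDerivAt t (hF t)).congr_deriv (by simp [A, p₁])
  have h2 : ∀ t, HasDerivAt (fun t => p₂ (F t)) (p₃ (F t) + T * p₂ (F t) - D * p₁ (F t)) t :=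
    fun t => (p₂.hasFDerivAt.comp_hasDerivAt t (hF t)).congr_deriv (by simp [A, p₁, p₂, p₃])
  have h3 : ∀ t, HasDerivAt (fun t => p₃ (F t)) 0 t := fun t =>
    (p₃.hasFDerivAt.comp_hasDerivAt t (hF t)).congr_deriv (by simp [A, p₃])
  have h3' : ∀ t, p₃ (F t) = 1 := fun t => by
    rw [is_const_of_deriv_eq_zero (fun t => (h3 t).differentiableAt) (fun t => (h3 t).deriv) t 0,
      hF0]
    simp [p₃, v]
  refine ⟨fun t => p₁ (F t), fun t => p₂ (F t), h1, fun t => ?_, ?_, ?_, fun t => ?_⟩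
  · simpa [h3'] using h2 t
  · simp [hF0, p₁, v]
  · simp [hF0, p₂, v]
  · have hlin := (p₁.comp (ContinuousLinearMap.apply ℝ (ℝ × ℝ × ℝ) v)).analyticAt
      (NormedSpace.exp (t • A))
    have hexp : AnalyticAt ℝ (fun t : ℝ => NormedSpace.exp (t • A)) t :=
      (NormedSpace.exp_analytic (𝕂 := ℝ) (t • A)).fun_comp
        (f := fun t : ℝ => t • A) (analyticAt_id.smul analyticAt_const)
    exact hlin.fun_comp (f := fun t : ℝ => NormedSpace.exp (t • A)) hexp

namespace IsFundamental

variable {T D : ℝ} {g s : ℝ → ℝ}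

theorem deriv_g (h : IsFundamental T D g s) : deriv g = s := funext fun t => (h.hg t).deriv

theorem analyticAt_s (h : IsFundamental T D g s) (t : ℝ) : AnalyticAt ℝ s t :=
  h.deriv_g ▸ (h.ag t).deriv

/-- The solution of the Liénard system starting at `(0, y₀)`. -/
theorem isLienardSolution (h : IsFundamental T D g s) (a y₀ : ℝ) :
    IsLienardSolution a T D (fun t => (a * g t - y₀ * s t,
      T * (a * g t - y₀ * s t) - (a * s t - y₀ * (1 + T * s t - D * g t)))) := fun t => by
  have hx := ((h.hg t).const_mul a).sub ((h.hs t).const_mul y₀)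
  have hr := (((h.hs t).const_mul T).const_add 1).sub ((h.hg t).const_mul D)
  refine (hx.prodMk ((hx.const_mul T).sub
    (((h.hs t).const_mul a).sub (hr.const_mul y₀)))).congr_deriv ?_
  simp only [lienardField, Prod.mk.injEq]
  constructor <;> ring

theorem eq_of_isLienardSolution (h : IsFundamental T D g s) {a y₀ : ℝ} {Φ : ℝ → ℝ × ℝ}
    (hΦ : IsLienardSolution a T D Φ) (h0 : Φ 0 = (0, y₀)) (t : ℝ) :
    Φ t = (a * g t - y₀ * s t,
      T * (a * g t - y₀ * s t) - (a * s t - y₀ * (1 + T * s t - D * g t))) :=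
  congrFun (hΦ.unique (h.isLienardSolution a y₀) (by simp [h0, h.g0, h.s0])) t

theorem neg (h : IsFundamental T D g s) :
    IsFundamental (-T) D (fun t => g (-t)) (fun t => -s (-t)) where
  hg t := ((h.hg (-t)).comp t (hasDerivAt_neg t)).congr_deriv (by simp)
  hs t := (((h.hs (-t)).comp t (hasDerivAt_neg t)).neg).congr_deriv (by ring)
  g0 := by simp [h.g0]
  s0 := by simp [h.s0]
  ag t := (h.ag (-t)).fun_comp analyticAt_id.neg

theorem hasDerivAt_exp (T t : ℝ) : HasDerivAt (fun t => Real.exp (T * t)) (T * Real.exp (T * t)) t :=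
  (((hasDerivAt_id t).const_mul T).exp).congr_deriv (by simp [mul_comm])

/-- Both `s(t)` and `-exp (T t) s(-t)` solve `u'' - T u' + D u = 0` with the same initial data. -/
theorem s_neg (h : IsFundamental T D g s) (t : ℝ) :
    s (-t) = -(Real.exp (-(T * t)) * s t) := by
  have hs' : ∀ t, HasDerivAt (fun t => s (-t)) (-(1 + T * s (-t) - D * g (-t))) t := fun t =>
    ((h.hs (-t)).comp t (hasDerivAt_neg t)).congr_deriv (by ring)
  have hg' : ∀ t, HasDerivAt (fun t => g (-t)) (-s (-t)) t := fun t =>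
    ((h.hg (-t)).comp t (hasDerivAt_neg t)).congr_deriv (by ring)
  have hr : ∀ t, HasDerivAt (fun t => 1 + T * s t - D * g t)
      (T * (1 + T * s t - D * g t) - D * s t) t := fun t =>
    (((h.hs t).const_mul T).const_add 1).sub ((h.hg t).const_mul D)
  have hr' : ∀ t, HasDerivAt (fun t => 1 + T * s (-t) - D * g (-t))
      (T * -(1 + T * s (-t) - D * g (-t)) - D * -s (-t)) t := fun t =>
    (((hs' t).const_mul T).const_add 1).sub ((hg' t).const_mul D)
  -- With `a = 0` the system is the second-order equation for `x`, with `y = T x - x'`; here `x` is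
  -- the sum that has to vanish.
  have hsol : IsLienardSolution 0 T D (fun t => (s t + Real.exp (T * t) * s (-t),
      T * (s t + Real.exp (T * t) * s (-t)) - ((1 + T * s t - D * g t)
        + (T * Real.exp (T * t) * s (-t)
          - Real.exp (T * t) * (1 + T * s (-t) - D * g (-t)))))) := fun t => by
    have hx := (h.hs t).add ((hasDerivAt_exp T t).mul (hs' t))
    refine (hx.prodMk ((hx.const_mul T).sub ((hr t).add
      ((((hasDerivAt_exp T t).const_mul T).mul (hs' t)).sub
        ((hasDerivAt_exp T t).mul (hr' t)))))).congr_deriv ?_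
    simp only [lienardField, Prod.mk.injEq]
    constructor <;> ring
  have hzero : IsLienardSolution 0 T D (fun _ => (0, 0)) := fun t =>
    (hasDerivAt_const t ((0 : ℝ), (0 : ℝ))).congr_deriv (by simp [lienardField, Prod.zero_eq_mk])
  have key := congrArg Prod.fst (congrFun (hsol.unique hzero (by simp [h.g0, h.s0])) t)
  simp only at key
  have he : Real.exp (-(T * t)) * Real.exp (T * t) = 1 := by rw [← Real.exp_add]; simp
  linear_combination Real.exp (-(T * t)) * key - s (-t) * he

/-- The left side is `s² - g s'`, the numerator of `(g / s)'`. After multiplication by `exp (-T t)`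
its derivative is `-s(-t)`, which is also that of `g(-t)`. -/
theorem wronskian (h : IsFundamental T D g s) (t : ℝ) :
    s t ^ 2 - g t * (1 + T * s t - D * g t) = Real.exp (T * t) * g (-t) := by
  have he : ∀ t, Real.exp (-T * t) * Real.exp (T * t) = 1 := fun t => by
    rw [← Real.exp_add]; simp
  have hg' : ∀ t, HasDerivAt (fun t => g (-t)) (-s (-t)) t := fun t =>
    ((h.hg (-t)).comp t (hasDerivAt_neg t)).congr_deriv (by ring)
  have hd : ∀ t, HasDerivAt (fun t => Real.exp (-T * t) *
      (s t ^ 2 - g t * (1 + T * s t - D * g t)) - g (-t)) 0 t := fun t => by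
    refine (((hasDerivAt_exp (-T) t).mul (((h.hs t).pow 2).sub ((h.hg t).mul
      ((((h.hs t).const_mul T).const_add 1).sub ((h.hg t).const_mul D))))).sub
        (hg' t)).congr_deriv ?_
    simp only [Pi.sub_apply, Pi.mul_apply, Pi.pow_apply, h.s_neg t, neg_mul]
    push_cast
    ring
  have key := is_const_of_deriv_eq_zero (fun t => (hd t).differentiableAt)
    (fun t => (hd t).deriv) t 0
  simp only [h.g0, h.s0, neg_zero] at key
  linear_combination Real.exp (T * t) * key -
    (s t ^ 2 - g t * (1 + T * s t - D * g t)) * he t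

end IsFundamental

/-! ### Positive times and the parametrization `Y = a g / s`. -/

/-- The times `t` such that `s` is positive on `(0, |t|]`. -/
def positiveTimes (s : ℝ → ℝ) : Set ℝ := {t | ∀ u ∈ Ioc 0 |t|, 0 < s u}

theorem zero_mem_positiveTimes (s : ℝ → ℝ) : (0 : ℝ) ∈ positiveTimes s := by
  rintro u ⟨h1, h2⟩
  rw [abs_zero] at h2
  exact absurd h1 h2.not_gt

theorem neg_mem_positiveTimes {s : ℝ → ℝ} {t : ℝ} (ht : t ∈ positiveTimes s) :
    -t ∈ positiveTimes s := by
  simpa [positiveTimes] using ht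

theorem positiveTimes_mono {s : ℝ → ℝ} {t u : ℝ} (ht : t ∈ positiveTimes s) (hu : |u| ≤ |t|) :
    u ∈ positiveTimes s := fun v hv => ht v ⟨hv.1, hv.2.trans hu⟩

theorem ordConnected_positiveTimes (s : ℝ → ℝ) : (positiveTimes s).OrdConnected := by
  refine ⟨fun x hx y hy z hz => ?_⟩
  rcases le_total 0 z with h | h
  · exact positiveTimes_mono hy (by rw [abs_of_nonneg h]; exact hz.2.trans (le_abs_self y))
  · exact positiveTimes_mono hx (by
      rw [abs_of_nonpos h]; exact (neg_le_neg hz.1).trans (neg_le_abs x))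

/-- The ordinate `y₀` for which the solution `a g - y₀ s` vanishes at time `t` (and `0` at time
`0`, in accordance with the limit `t → 0`). -/
noncomputable def crossing (a : ℝ) (g s : ℝ → ℝ) (t : ℝ) : ℝ := a * g t / s t

namespace IsFundamental

variable {T D : ℝ} {g s : ℝ → ℝ}

theorem continuous_s (h : IsFundamental T D g s) : Continuous s :=
  continuous_iff_continuousAt.2 fun t => (h.hs t).continuousAt

theorem continuous_g (h : IsFundamental T D g s) : Continuous g :=
  continuous_iff_continuousAt.2 fun t => (h.hg t).continuousAt

theorem isOpen_positiveTimes (h : IsFundamental T D g s) : IsOpen (positiveTimes s) := by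
  have h0 : ∃ δ > 0, ∀ u ∈ Ioo 0 δ, 0 < s u := by
    have h1 := (h.hs 0).tendsto_slope_zero_right
    simp only [h.s0, h.g0, zero_add, sub_zero, mul_zero, add_zero, smul_eq_mul] at h1
    have h2 := (h1.eventually (lt_mem_nhds one_pos)).and self_mem_nhdsWithin
    obtain ⟨δ, hδ, hs⟩ := mem_nhdsGT_iff_exists_Ioo_subset.1 h2
    exact ⟨δ, hδ, fun u hu => (mul_pos_iff_of_pos_left (inv_pos.2 hu.1)).1 (hs hu).1⟩
  obtain ⟨δ, hδ, h0⟩ := h0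
  rw [Metric.isOpen_iff]
  intro t ht
  rcases eq_or_ne t 0 with rfl | hne
  · refine ⟨δ, hδ, fun v hv u hu => h0 u ⟨hu.1, hu.2.trans_lt ?_⟩⟩
    simpa [Real.dist_eq] using hv
  · obtain ⟨ε, hε, hs⟩ := Metric.eventually_nhds_iff.1
      (h.continuous_s.continuousAt.eventually (lt_mem_nhds (ht |t| ⟨abs_pos.2 hne, le_rfl⟩)))
    refine ⟨ε, hε, fun v hv u hu => ?_⟩
    rcases le_or_gt u |t| with h1 | h1
    · exact ht u ⟨hu.1, h1⟩
    · refine hs ?_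
      rw [Metric.mem_ball, Real.dist_eq] at hv
      rw [Real.dist_eq, abs_of_pos (sub_pos.2 h1)]
      linarith [hu.2, abs_sub_abs_le_abs_sub v t]

theorem positiveTimes_neg (h : IsFundamental T D g s) :
    positiveTimes (fun t => -s (-t)) = positiveTimes s := by
  have : ∀ u, 0 < -s (-u) ↔ 0 < s u := fun u => by
    rw [h.s_neg, neg_neg, mul_pos_iff_of_pos_left (Real.exp_pos _)]
  simp only [positiveTimes, this]

theorem s_pos {t : ℝ} (ht : t ∈ positiveTimes s) (h0 : 0 < t) : 0 < s t :=
  ht t ⟨h0, le_abs_self t⟩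

theorem s_ne_zero (h : IsFundamental T D g s) {t : ℝ} (ht : t ∈ positiveTimes s) (h0 : t ≠ 0) :
    s t ≠ 0 := by
  rcases h0.lt_or_gt with h1 | h1
  · have h2 := s_pos (neg_mem_positiveTimes ht) (neg_pos.2 h1)
    rw [h.s_neg] at h2
    rintro h3
    simp [h3] at h2
  · exact (s_pos ht h1).ne'

theorem g_pos_of_forall (h : IsFundamental T D g s) {t : ℝ} (ht : 0 < t)
    (hs : ∀ u ∈ Ioo 0 t, 0 < s u) : 0 < g t := by
  have h1 : StrictMonoOn g (Icc 0 t) := by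
    refine strictMonoOn_of_deriv_pos (convex_Icc 0 t) h.continuous_g.continuousOn ?_
    rw [interior_Icc, h.deriv_g]
    exact hs
  simpa [h.g0] using h1 (left_mem_Icc.2 ht.le) (right_mem_Icc.2 ht.le) ht

theorem g_pos (h : IsFundamental T D g s) {t : ℝ} (ht : t ∈ positiveTimes s) (h0 : t ≠ 0) :
    0 < g t := by
  rcases h0.lt_or_gt with h1 | h1
  · have h2 := h.neg.g_pos_of_forall (neg_pos.2 h1) fun u hu => by
      have h3 := s_pos (s := fun t => -s (-t)) (t := u) (by
        rw [h.positiveTimes_neg]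
        exact positiveTimes_mono ht
          (by rw [abs_of_pos hu.1, abs_of_neg h1]; exact hu.2.le)) hu.1
      exact h3
    simpa using h2
  · exact h.g_pos_of_forall h1 fun u hu => ht u ⟨hu.1, hu.2.le.trans (le_abs_self t)⟩

theorem crossing_zero (h : IsFundamental T D g s) (a : ℝ) : crossing a g s 0 = 0 := by
  simp [crossing, h.g0]

theorem hasDerivAt_crossing (h : IsFundamental T D g s) (a : ℝ) {t : ℝ} (hs : s t ≠ 0) :
    HasDerivAt (crossing a g s) (a * (Real.exp (T * t) * g (-t)) / s t ^ 2) t := by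
  refine (((h.hg t).const_mul a).div (h.hs t) hs).congr_deriv ?_
  rw [← h.wronskian]
  ring

theorem lienardW_crossing (h : IsFundamental T D g s) (a : ℝ) {t : ℝ} (hs : s t ≠ 0) :
    lienardW a T D (crossing a g s t) =
      a ^ 2 * (Real.exp (T * t) * g (-t) + g t) / s t ^ 2 := by
  rw [← h.wronskian, lienardW, crossing]
  field_simp
  ring

/-- A differential equation for `Y`: it yields `Y'(0)` in the limit, and a lower bound for `Y'` once
`s` is large. -/
theorem lienardW_crossing_eq (h : IsFundamental T D g s) (a : ℝ) {t : ℝ} (hs : s t ≠ 0) :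
    lienardW a T D (crossing a g s t) =
      a * deriv (crossing a g s) t + a * crossing a g s t / s t := by
  rw [h.lienardW_crossing a hs, (h.hasDerivAt_crossing a hs).deriv, crossing]
  field_simp

theorem lienardW_crossing_pos (h : IsFundamental T D g s) {a : ℝ} (ha : 0 < a) {t : ℝ}
    (ht : t ∈ positiveTimes s) : 0 < lienardW a T D (crossing a g s t) := by
  rcases eq_or_ne t 0 with rfl | h0
  · simpa [h.crossing_zero, lienardW] using pow_pos ha 2
  · have hs := h.s_ne_zero ht h0
    have h1 := h.g_pos ht h0
    have h2 := h.g_pos (neg_mem_positiveTimes ht) (neg_ne_zero.2 h0)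
    rw [h.lienardW_crossing a hs]
    positivity

theorem analyticAt_dslope {f : ℝ → ℝ} (hf : AnalyticAt ℝ f 0) : AnalyticAt ℝ (dslope f 0) 0 := by
  obtain ⟨p, hp⟩ := hf
  exact hp.has_fpower_series_dslope_fslope.analyticAt

theorem analyticAt_crossing (h : IsFundamental T D g s) (a : ℝ) {t : ℝ}
    (ht : t ∈ positiveTimes s) : AnalyticAt ℝ (crossing a g s) t := by
  rcases eq_or_ne t 0 with rfl | h0
  -- Numerator and denominator are both divided by `t`; the new denominator has value `s'(0) = 1` at
  -- `0`, and the convention `0 / 0 = 0` agrees with the limit.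
  · have h1 : crossing a g s = fun t => a * dslope g 0 t / dslope s 0 t := by
      funext t
      rcases eq_or_ne t 0 with rfl | ht0
      · simp [h.crossing_zero, (h.hg 0).deriv, h.s0]
      · rw [crossing, dslope_of_ne _ ht0, dslope_of_ne _ ht0, slope_def_field, slope_def_field,
          h.g0, h.s0, sub_zero, sub_zero, sub_zero]
        field_simp
    rw [h1]
    refine (analyticAt_const.mul (analyticAt_dslope (h.ag 0))).div
      (analyticAt_dslope (h.analyticAt_s 0)) ?_
    simp [(h.hs 0).deriv, h.s0, h.g0]
  · exact (analyticAt_const.mul (h.ag t)).div (h.analyticAt_s t) (h.s_ne_zero ht h0)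

theorem deriv_crossing_zero (h : IsFundamental T D g s) {a : ℝ} (ha : a ≠ 0) :
    deriv (crossing a g s) 0 = a / 2 := by
  have hY := h.analyticAt_crossing a (zero_mem_positiveTimes s)
  have l1 := hasDerivAt_iff_tendsto_slope.1 (h.hs 0)
  have l2 := hasDerivAt_iff_tendsto_slope.1 hY.differentiableAt.hasDerivAt
  have l3 : Tendsto (deriv (crossing a g s)) (𝓝[≠] 0) (𝓝 (deriv (crossing a g s) 0)) :=
    hY.deriv.continuousAt.tendsto.mono_left nhdsWithin_le_nhds
  have l4 : Tendsto (fun t => lienardW a T D (crossing a g s t)) (𝓝[≠] 0)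
      (𝓝 (lienardW a T D (crossing a g s 0))) := by
    have hc : Continuous (lienardW a T D) := by unfold lienardW; fun_prop
    exact (hc.continuousAt.comp hY.continuousAt).tendsto.mono_left nhdsWithin_le_nhds
  -- The equation for `Y` times `s(t) / t`; its limit at `0` is `a² = 2 a Y'(0)`.
  have e : (fun t => lienardW a T D (crossing a g s t) * slope s 0 t) =ᶠ[𝓝[≠] 0]
      fun t => a * deriv (crossing a g s) t * slope s 0 t + a * slope (crossing a g s) 0 t := by
    filter_upwards [self_mem_nhdsWithin,
      nhdsWithin_le_nhds (h.isOpen_positiveTimes.mem_nhds (zero_mem_positiveTimes s))]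
      with t h0 ht
    have hs := h.s_ne_zero ht h0
    have h0' : t ≠ 0 := h0
    rw [h.lienardW_crossing_eq a hs, slope_def_field, slope_def_field, h.crossing_zero, h.s0,
      sub_zero, sub_zero, sub_zero]
    field_simp
  have key := tendsto_nhds_unique ((l4.mul l1).congr' e)
    (((l3.const_mul a).mul l1).add (l2.const_mul a))
  simp only [h.crossing_zero, lienardW, h.s0, h.g0] at key
  have : a * (a - 2 * deriv (crossing a g s) 0) = 0 := by linear_combination key
  have := (mul_eq_zero.1 this).resolve_left ha
  linarith

theorem deriv_crossing_pos (h : IsFundamental T D g s) {a : ℝ} (ha : 0 < a) {t : ℝ}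
    (ht : t ∈ positiveTimes s) : 0 < deriv (crossing a g s) t := by
  rcases eq_or_ne t 0 with rfl | h0
  · rw [h.deriv_crossing_zero ha.ne']
    positivity
  · have hs := h.s_ne_zero ht h0
    have h2 := h.g_pos (neg_mem_positiveTimes ht) (neg_ne_zero.2 h0)
    rw [(h.hasDerivAt_crossing a hs).deriv]
    positivity

theorem continuousOn_crossing (h : IsFundamental T D g s) (a : ℝ) :
    ContinuousOn (crossing a g s) (positiveTimes s) := fun _ ht =>
  (h.analyticAt_crossing a ht).continuousAt.continuousWithinAt

theorem strictMonoOn_crossing (h : IsFundamental T D g s) {a : ℝ} (ha : 0 < a) :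
    StrictMonoOn (crossing a g s) (positiveTimes s) :=
  strictMonoOn_of_deriv_pos (ordConnected_positiveTimes s).convex (h.continuousOn_crossing a)
    fun _ ht => h.deriv_crossing_pos ha (interior_subset ht)

theorem crossing_neg (h : IsFundamental T D g s) (a t : ℝ) :
    crossing a g s (-t) = -(a * Real.exp (T * t) * g (-t) / s t) := by
  rw [crossing, h.s_neg, Real.exp_neg]
  field_simp

/-! ### The image of `Y` is the positivity interval of `W`. -/

/-- At a first zero of `s` one would have `g > 0`, so `Y` would blow up. The bound `a g ≤ y s`
passes to the closure and keeps `s` positive there. -/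
theorem positiveTimes_eq_univ_of_crossing_lt (h : IsFundamental T D g s) {a y : ℝ} (ha : 0 < a)
    (hy : 0 < y) (hlt : ∀ t ∈ positiveTimes s, 0 ≤ t → crossing a g s t < y) :
    positiveTimes s = univ := by
  refine IsClopen.eq_univ ⟨?_, h.isOpen_positiveTimes⟩ ⟨0, zero_mem_positiveTimes s⟩
  refine closure_subset_iff_isClosed.1 fun t ht => ?_
  rcases eq_or_ne t 0 with rfl | h0
  · exact zero_mem_positiveTimes s
  have hpos : 0 < |t| := abs_pos.2 h0
  have hlt' : ∀ u, |u| < |t| → u ∈ positiveTimes s := fun u hu => by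
    obtain ⟨v, hv, hd⟩ := Metric.mem_closure_iff.1 ht (|t| - |u|) (sub_pos.2 hu)
    rw [Real.dist_eq] at hd
    exact positiveTimes_mono hv (by linarith [abs_sub_abs_le_abs_sub t v])
  have hs : ∀ u ∈ Ioo 0 |t|, 0 < s u := fun u hu =>
    s_pos (hlt' u (by rw [abs_of_pos hu.1]; exact hu.2)) hu.1
  have hg := h.g_pos_of_forall hpos hs
  have hle : a * g |t| ≤ y * s |t| := by
    refine ContinuousWithinAt.closure_le (s := Ioo 0 |t|)
      (f := fun u => a * g u) (g := fun u => y * s u) ?_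
      (h.continuous_g.const_mul a).continuousWithinAt
      (h.continuous_s.const_mul y).continuousWithinAt fun u hu => ?_
    · rw [closure_Ioo hpos.ne]
      exact right_mem_Icc.2 hpos.le
    · have := hlt u (hlt' u (by rw [abs_of_pos hu.1]; exact hu.2)) hu.1.le
      rw [crossing, div_lt_iff₀ (hs u hu)] at this
      exact this.le
  intro u hu
  rcases hu.2.lt_or_eq with h1 | rfl
  · exact hs u ⟨hu.1, h1⟩
  · exact (mul_pos_iff_of_pos_left hy).1 ((mul_pos ha hg).trans_le hle)

/-- If `Y < y` throughout, then `s` never vanishes for `t > 0` and `s > (a / y) g`, so `g`, and with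
it `s`, grows at least linearly. As `W(Y) ≥ c > 0`, the equation `a Y' = W(Y) - a Y / s` gives `a Y'
≥ c / 2` eventually, and `Y` is unbounded. -/
theorem exists_le_crossing (h : IsFundamental T D g s) {a y : ℝ} (ha : 0 < a) (hy : 0 < y)
    (hW : ∀ z ∈ Icc 0 y, 0 < lienardW a T D z) :
    ∃ t ∈ positiveTimes s, 0 ≤ t ∧ y ≤ crossing a g s t := by
  by_contra! hlt
  have hJ := h.positiveTimes_eq_univ_of_crossing_lt ha hy hlt
  have hJ' : ∀ t, t ∈ positiveTimes s := fun t => hJ ▸ mem_univ t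
  have hs : ∀ t, 0 < t → 0 < s t := fun t ht => s_pos (hJ' t) ht
  have hgs : ∀ t, 0 < t → a / y * g t < s t := fun t ht => by
    have := hlt t (hJ' t) ht.le
    rw [crossing, div_lt_iff₀ (hs t ht)] at this
    rw [div_mul_eq_mul_div, div_lt_iff₀ hy]
    linarith
  have hay : 0 < a / y := div_pos ha hy
  have hg1 : 0 < g 1 := h.g_pos (hJ' 1) one_ne_zero
  have hmono : ∀ t, 1 ≤ t → g 1 ≤ g t := fun t ht => by
    refine (monotoneOn_of_deriv_nonneg (convex_Ici 1) h.continuous_g.continuousOn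
      (fun u _ => (h.hg u).differentiableAt.differentiableWithinAt) fun u hu => ?_)
      self_mem_Ici ht ht
    rw [interior_Ici] at hu
    rw [h.deriv_g]
    exact (hs u (one_pos.trans hu)).le
  have hσ : 0 < a / y * g 1 := mul_pos hay hg1
  have hlin : ∀ t, 1 ≤ t → a / y * g 1 * (t - 1) ≤ g t := fun t ht => by
    have := (convex_Ici (1 : ℝ)).mul_sub_le_image_sub_of_le_deriv
      h.continuous_g.continuousOn
      (fun u _ => (h.hg u).differentiableAt.differentiableWithinAt) (C := a / y * g 1)
      (fun u hu => by
        rw [interior_Ici] at hu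
        rw [h.deriv_g]
        have h1 := mul_le_mul_of_nonneg_left (hmono u (le_of_lt hu)) hay.le
        linarith [hgs u (one_pos.trans hu)]) 1 self_mem_Ici t ht ht
    linarith
  obtain ⟨c, hc, hcW⟩ : ∃ c > 0, ∀ z ∈ Icc 0 y, c ≤ lienardW a T D z := by
    have hcont : ContinuousOn (lienardW a T D) (Icc 0 y) := by unfold lienardW; fun_prop
    obtain ⟨z, hz, hmin⟩ := isCompact_Icc.exists_isMinOn (nonempty_Icc.2 hy.le) hcont
    exact ⟨_, hW z hz, fun w hw => hmin hw⟩
  have hY0 : ∀ t, 0 < t → 0 ≤ crossing a g s t := fun t ht =>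
    div_nonneg (mul_nonneg ha.le (h.g_pos (hJ' t) ht.ne').le) (hs t ht).le
  -- This size of `s` makes `a Y / s ≤ c / 2`, since `Y < y`.
  obtain ⟨t₁, ht₁, hst⟩ : ∃ t₁, 1 ≤ t₁ ∧ ∀ t, t₁ ≤ t → 2 * a * y / c ≤ s t := by
    refine ⟨1 + (2 * a * y / c) / (a / y * (a / y * g 1)), ?_, fun t ht => ?_⟩
    · have : 0 < (2 * a * y / c) / (a / y * (a / y * g 1)) := by positivity
      linarith
    · have h1 : 0 < (2 * a * y / c) / (a / y * (a / y * g 1)) := by positivity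
      have h2 : 1 ≤ t := by linarith
      have h3 : 2 * a * y / c ≤ (t - 1) * (a / y * (a / y * g 1)) := by
        rw [← div_le_iff₀ (by positivity)]
        linarith
      have h4 := mul_le_mul_of_nonneg_left (hlin t h2) hay.le
      nlinarith [hgs t (by linarith)]
  have hder : ∀ t, t₁ ≤ t → c / (2 * a) ≤ deriv (crossing a g s) t := fun t ht => by
    have h0 : 0 < t := by linarith
    have h1 := h.lienardW_crossing_eq a (hs t h0).ne'
    have h2 := hcW _ ⟨hY0 t h0, (hlt t (hJ' t) h0.le).le⟩
    have h3 : a * crossing a g s t / s t ≤ c / 2 := by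
      rw [div_le_iff₀ (hs t h0)]
      have h4 := hst t ht
      rw [div_le_iff₀ hc] at h4
      nlinarith [hlt t (hJ' t) h0.le]
    rw [div_le_iff₀ (by positivity)]
    linarith
  have hfin := (convex_Ici t₁).mul_sub_le_image_sub_of_le_deriv
    ((h.continuousOn_crossing a).mono fun t _ => hJ' t)
    (fun t _ => (h.analyticAt_crossing a (hJ' t)).differentiableAt.differentiableWithinAt)
    (C := c / (2 * a)) (fun t ht => hder t (interior_subset ht)) t₁ self_mem_Ici
    (t₁ + y / (c / (2 * a))) (by
      have : 0 < y / (c / (2 * a)) := by positivity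
      simp only [mem_Ici]; linarith)
    (by have : 0 < y / (c / (2 * a)) := by positivity
        linarith)
  have h5 : c / (2 * a) * (t₁ + y / (c / (2 * a)) - t₁) = y := by field_simp; ring
  have h6 : 0 < y / (c / (2 * a)) := by positivity
  linarith [hY0 t₁ (by linarith), hlt (t₁ + y / (c / (2 * a))) (hJ' _) (by linarith)]

theorem exists_crossing_eq (h : IsFundamental T D g s) {a y : ℝ} (ha : 0 < a) (hy : 0 ≤ y)
    (hW : ∀ z ∈ Icc 0 y, 0 < lienardW a T D z) :
    ∃ t ∈ positiveTimes s, crossing a g s t = y := by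
  rcases hy.eq_or_lt with rfl | hy
  · exact ⟨0, zero_mem_positiveTimes s, h.crossing_zero a⟩
  obtain ⟨t, ht, h0, hle⟩ := h.exists_le_crossing ha hy hW
  have hsub : Icc 0 t ⊆ positiveTimes s :=
    (ordConnected_positiveTimes s).out (zero_mem_positiveTimes s) ht
  obtain ⟨u, hu, hYu⟩ := intermediate_value_Icc h0 ((h.continuousOn_crossing a).mono hsub)
    (show y ∈ _ from ⟨by rw [h.crossing_zero]; exact hy.le, hle⟩)
  exact ⟨u, hsub hu, hYu⟩

end IsFundamental

theorem lienardW_pos_of_mem {a T D y : ℝ} (hy : y ∈ positivityInterval a T D) :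
    0 < lienardW a T D y := by
  simpa using connectedComponentIn_subset _ _ hy

theorem lienardW_neg (a T D y : ℝ) : lienardW a T D (-y) = lienardW a (-T) D y := by
  simp only [lienardW]
  ring

namespace IsFundamental

variable {T D : ℝ} {g s : ℝ → ℝ}

/-- The image is connected, contains `0` and lies in `W > 0`. Conversely, `y ≥ 0` is reached by the
intermediate value theorem, and `y ≤ 0` by reversing time, which changes `T` to `-T` and `y` to
`-y`. -/
theorem image_crossing (h : IsFundamental T D g s) {a : ℝ} (ha : 0 < a) :
    crossing a g s '' positiveTimes s = positivityInterval a T D := by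
  have hW0 : (0 : ℝ) ∈ {y | 0 < lienardW a T D y} := by
    simpa [lienardW] using pow_pos ha 2
  apply Subset.antisymm
  · refine IsPreconnected.subset_connectedComponentIn ?_
      ⟨0, zero_mem_positiveTimes s, h.crossing_zero a⟩ ?_
    · exact (ordConnected_positiveTimes s).isPreconnected.image _ (h.continuousOn_crossing a)
    · rintro _ ⟨t, ht, rfl⟩
      exact h.lienardW_crossing_pos ha ht
  · intro y hy
    have hoc : (positivityInterval a T D).OrdConnected :=
      isPreconnected_connectedComponentIn.ordConnected
    have h0 : (0 : ℝ) ∈ positivityInterval a T D := mem_connectedComponentIn hW0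
    rcases le_total 0 y with hy0 | hy0
    · exact h.exists_crossing_eq ha hy0 fun z hz =>
        lienardW_pos_of_mem (hoc.out h0 hy hz)
    · obtain ⟨t, ht, hYt⟩ := h.neg.exists_crossing_eq (y := -y) ha (by linarith) fun z hz => by
        rw [← lienardW_neg]
        exact lienardW_pos_of_mem
          (hoc.out hy h0 (show -z ∈ Icc y 0 from ⟨by linarith [hz.2], by linarith [hz.1]⟩))
      rw [h.positiveTimes_neg] at ht
      refine ⟨-t, neg_mem_positiveTimes ht, ?_⟩
      simp only [crossing, div_neg] at hYt ⊢
      linarith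

end IsFundamental

/-! ### The involution and its differential equation. -/

/-- The involution exchanging `crossing a g s t` and `crossing a g s (-t)`. -/
noncomputable def crossingInvolution (a : ℝ) (g s : ℝ → ℝ) (y : ℝ) : ℝ :=
  crossing a g s (-Function.invFunOn (crossing a g s) (positiveTimes s) y)

namespace IsFundamental

variable {T D : ℝ} {g s : ℝ → ℝ} {a : ℝ}

theorem crossingInvolution_crossing (h : IsFundamental T D g s) (ha : 0 < a) {t : ℝ}
    (ht : t ∈ positiveTimes s) :
    crossingInvolution a g s (crossing a g s t) = crossing a g s (-t) := by
  rw [crossingInvolution, (h.strictMonoOn_crossing ha).injOn.leftInvOn_invFunOn ht]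

theorem mapsTo_crossingInvolution (h : IsFundamental T D g s) (ha : 0 < a) :
    MapsTo (crossingInvolution a g s) (positivityInterval a T D) (positivityInterval a T D) := by
  rw [← h.image_crossing ha]
  rintro _ ⟨t, ht, rfl⟩
  rw [h.crossingInvolution_crossing ha ht]
  exact mem_image_of_mem _ (neg_mem_positiveTimes ht)

theorem crossingInvolution_involutive (h : IsFundamental T D g s) (ha : 0 < a) :
    ∀ y ∈ positivityInterval a T D,
      crossingInvolution a g s (crossingInvolution a g s y) = y := by
  rw [← h.image_crossing ha]
  rintro _ ⟨t, ht, rfl⟩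
  rw [h.crossingInvolution_crossing ha ht,
    h.crossingInvolution_crossing ha (neg_mem_positiveTimes ht), neg_neg]

/-- `Y` is a local analytic change of variable, and `φ ∘ Y = Y(-·)` is analytic. -/
theorem analyticOnNhd_crossingInvolution (h : IsFundamental T D g s) (ha : 0 < a) :
    AnalyticOnNhd ℝ (crossingInvolution a g s) (positivityInterval a T D) := by
  rw [← h.image_crossing ha]
  rintro _ ⟨t, ht, rfl⟩
  have hY := h.analyticAt_crossing a ht
  rw [← analyticAt_comp_iff_of_deriv_ne_zero hY (h.deriv_crossing_pos ha ht).ne']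
  have hY' := h.analyticAt_crossing a (neg_mem_positiveTimes ht)
  refine (hY'.fun_comp (f := fun t => -t) analyticAt_id.neg).congr ?_
  filter_upwards [h.isOpen_positiveTimes.mem_nhds ht] with u hu
  exact (h.crossingInvolution_crossing ha hu).symm

theorem crossingInvolution_zero (h : IsFundamental T D g s) (ha : 0 < a) :
    crossingInvolution a g s 0 = 0 := by
  have := h.crossingInvolution_crossing ha (zero_mem_positiveTimes s)
  rwa [neg_zero, h.crossing_zero] at this

theorem zero_mem_positivityInterval (h : IsFundamental T D g s) (ha : 0 < a) :
    (0 : ℝ) ∈ positivityInterval a T D := by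
  rw [← h.image_crossing ha]
  exact ⟨0, zero_mem_positiveTimes s, h.crossing_zero a⟩

theorem deriv_crossingInvolution (h : IsFundamental T D g s) (ha : 0 < a) {t : ℝ}
    (ht : t ∈ positiveTimes s) :
    deriv (crossingInvolution a g s) (crossing a g s t) * deriv (crossing a g s) t =
      -deriv (crossing a g s) (-t) := by
  have hY := (h.analyticAt_crossing a ht).differentiableAt.hasDerivAt
  have hY' := (h.analyticAt_crossing a (neg_mem_positiveTimes ht)).differentiableAt.hasDerivAt
  have hφ := (h.analyticOnNhd_crossingInvolution ha (crossing a g s t)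
    (h.image_crossing ha ▸ mem_image_of_mem _ ht)).differentiableAt.hasDerivAt
  have h1 := hφ.comp t hY
  have h2 := hY'.comp t (hasDerivAt_neg t)
  have h3 : crossingInvolution a g s ∘ crossing a g s =ᶠ[𝓝 t] crossing a g s ∘ Neg.neg := by
    filter_upwards [h.isOpen_positiveTimes.mem_nhds ht] with u hu
    exact h.crossingInvolution_crossing ha hu
  rw [h1.unique (h2.congr_of_eventuallyEq h3)]
  ring

theorem deriv_crossingInvolution_zero (h : IsFundamental T D g s) (ha : 0 < a) :
    deriv (crossingInvolution a g s) 0 = -1 := by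
  have h1 := h.deriv_crossingInvolution ha (zero_mem_positiveTimes s)
  rw [h.crossing_zero, neg_zero, h.deriv_crossing_zero ha.ne'] at h1
  have : a / 2 ≠ 0 := by positivity
  field_simp at h1
  linarith

/-- The differential equation `φ φ' W(y) = y W(φ)` of the involution. -/
theorem crossingInvolution_ode (h : IsFundamental T D g s) (ha : 0 < a) {y : ℝ}
    (hy : y ∈ positivityInterval a T D) :
    crossingInvolution a g s y * deriv (crossingInvolution a g s) y * lienardW a T D y =
      y * lienardW a T D (crossingInvolution a g s y) := by
  rw [← h.image_crossing ha] at hy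
  obtain ⟨t, ht, rfl⟩ := hy
  rcases eq_or_ne t 0 with rfl | h0
  · simp [h.crossing_zero, h.crossingInvolution_zero ha]
  have hs := h.s_ne_zero ht h0
  have hs' := h.s_ne_zero (neg_mem_positiveTimes ht) (neg_ne_zero.2 h0)
  have hd := h.deriv_crossingInvolution ha ht
  have hpos := h.g_pos (neg_mem_positiveTimes ht) (neg_ne_zero.2 h0)
  rw [(h.hasDerivAt_crossing a hs).deriv, (h.hasDerivAt_crossing a hs').deriv, neg_neg] at hd
  rw [h.crossingInvolution_crossing ha ht, h.lienardW_crossing a hs, h.lienardW_crossing a hs',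
    neg_neg]
  rw [h.s_neg, mul_neg, Real.exp_neg] at hd
  rw [crossing, h.s_neg, mul_neg, Real.exp_neg]
  have he := (Real.exp_pos (T * t)).ne'
  have hd' : deriv (crossingInvolution a g s) (crossing a g s t) = - g t / g (-t) := by
    field_simp at hd ⊢
    linarith
  rw [hd', crossing]
  field_simp
  ring

/-! ### Left returns and the half-map for `a > 0`. -/

/-- The abscissa at time `u` is `s(u) (Y(u) - Y(t))`, negative for `0 < u < t` because `Y`
increases. -/
theorem isLeftReturn_crossing (h : IsFundamental T D g s) (ha : 0 < a) {t : ℝ}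
    (ht : t ∈ positiveTimes s) (h0 : 0 < t) :
    IsLeftReturn a T D (crossing a g s t) (crossing a g s (-t)) := by
  have hs := s_pos ht h0
  refine ⟨_, h.isLienardSolution a (crossing a g s t), by simp [h.g0, h.s0], t, h0, ?_,
    fun u hu => ?_⟩
  · have h1 : a * g t - crossing a g s t * s t = 0 := by
      rw [crossing]
      field_simp
      ring
    simp only [h1, Prod.mk.injEq, true_and]
    rw [h.crossing_neg, mul_assoc, ← h.wronskian, crossing]
    field_simp
    ring
  · have hu' : u ∈ positiveTimes s :=
      positiveTimes_mono ht (by rw [abs_of_pos hu.1, abs_of_pos h0]; exact hu.2.le)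
    have h1 := h.strictMonoOn_crossing ha hu' ht hu.2
    rw [crossing, div_lt_iff₀ (s_pos hu' hu.1)] at h1
    simpa using h1

/-- What has to be excluded is a zero of `s` up to the return time. There `a g ≤ y₀ s`; small times
give `y₀ > 0`, and at the first `u` with `s(u) ≤ 0` one still has `g(u) > 0`, a contradiction. -/
theorem exists_of_isLeftReturn (h : IsFundamental T D g s) (ha : 0 < a) {y₀ y₁ : ℝ}
    (hr : IsLeftReturn a T D y₀ y₁) :
    ∃ t ∈ positiveTimes s, 0 < t ∧ y₀ = crossing a g s t ∧ y₁ = crossing a g s (-t) := by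
  obtain ⟨Φ, hΦ, hΦ0, τ, hτ, hΦτ, hneg⟩ := hr
  have hsol := h.eq_of_isLienardSolution hΦ hΦ0
  have hx : ∀ u ∈ Ioc 0 τ, a * g u ≤ y₀ * s u := fun u hu => by
    rcases hu.2.lt_or_eq with h1 | rfl
    · have := hneg u ⟨hu.1, h1⟩
      rw [hsol] at this
      simp only at this
      linarith
    · have := congrArg Prod.fst (hΦτ.symm.trans (hsol u))
      simp only at this
      linarith
  have hJ : τ ∈ positiveTimes s := by
    obtain ⟨δ, hδ, hball⟩ := Metric.isOpen_iff.1 h.isOpen_positiveTimes 0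
      (zero_mem_positiveTimes s)
    have hsmall : ∃ v ∈ positiveTimes s, v ∈ Ioc 0 τ := by
      refine ⟨min (δ / 2) τ, hball ?_, lt_min (half_pos hδ) hτ, min_le_right _ _⟩
      rw [Metric.mem_ball, Real.dist_eq, sub_zero, abs_of_pos (lt_min (half_pos hδ) hτ)]
      exact (min_le_left _ _).trans_lt (half_lt_self hδ)
    obtain ⟨v, hvJ, hv⟩ := hsmall
    have hy₀ : 0 < y₀ := by
      have h1 := hx v hv
      have h2 := mul_pos ha (h.g_pos hvJ hv.1.ne')
      exact (mul_pos_iff_of_pos_right (s_pos hvJ hv.1)).1 (h2.trans_le h1)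
    by_contra hcon
    -- `Z` contains the first non-positive value of `s` in `(0, τ]`
    set Z := {u ∈ Icc v τ | s u ≤ 0}
    have hZne : Z.Nonempty := by
      simp only [positiveTimes, mem_ofPred_eq, not_forall, not_lt] at hcon
      obtain ⟨u, hu, hsu⟩ := hcon
      rw [abs_of_pos hτ] at hu
      refine ⟨u, ⟨?_, hu.2⟩, hsu⟩
      by_contra! hlt
      exact hsu.not_gt (hvJ u ⟨hu.1, hlt.le.trans (le_abs_self v)⟩)
    have hZc : IsCompact Z :=
      isCompact_Icc.inter_right (isClosed_le h.continuous_s continuous_const)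
    obtain ⟨u, ⟨hu, hsu⟩, hmin⟩ := hZc.exists_isLeast hZne
    have hu0 : 0 < u := hv.1.trans_le hu.1
    have hgu := h.g_pos_of_forall hu0 fun w hw => by
      rcases le_or_gt w v with h1 | h1
      · exact hvJ w ⟨hw.1, h1.trans (le_abs_self v)⟩
      · by_contra! hsw
        exact hw.2.not_ge (hmin ⟨⟨h1.le, hw.2.le.trans hu.2⟩, hsw⟩)
    have h1 := hx u ⟨hu0, hu.2⟩
    nlinarith [mul_pos ha hgu]
  have hs := s_pos hJ hτ
  have hy₀ : y₀ = crossing a g s τ := by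
    have h1 := congrArg Prod.fst (hΦτ.symm.trans (hsol τ))
    simp only at h1
    rw [crossing, eq_div_iff hs.ne']
    linarith
  have hr' : IsLeftReturn a T D y₀ y₁ := ⟨Φ, hΦ, hΦ0, τ, hτ, hΦτ, hneg⟩
  refine ⟨τ, hJ, hτ, hy₀, ?_⟩
  subst hy₀
  exact hr'.unique (h.isLeftReturn_crossing ha hJ hτ)

/-- The parameter `t = 0` accounts for the extension `0 ↦ 0`: the origin has no return of its own,
as `Y > 0` at positive times. -/
theorem leftHalfMapGraph_iff (h : IsFundamental T D g s) (ha : 0 < a) {y₀ y₁ : ℝ} :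
    LeftHalfMapGraph a T D y₀ y₁ ↔
      ∃ t ∈ positiveTimes s, 0 ≤ t ∧ y₀ = crossing a g s t ∧ y₁ = crossing a g s (-t) := by
  have hmono := h.strictMonoOn_crossing ha
  have hpos : ∀ t ∈ positiveTimes s, 0 < t → 0 < crossing a g s t := fun t ht h0 => by
    simpa [h.crossing_zero] using hmono (zero_mem_positiveTimes s) ht h0
  have hneg : ∀ t ∈ positiveTimes s, 0 < t → crossing a g s (-t) < 0 := fun t ht h0 => by
    simpa [h.crossing_zero] using
      hmono (neg_mem_positiveTimes ht) (zero_mem_positiveTimes s) (neg_lt_zero.2 h0)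
  constructor
  · rintro (⟨-, hr⟩ | ⟨rfl, rfl, -⟩)
    · obtain ⟨t, ht, h0, h1⟩ := h.exists_of_isLeftReturn ha hr
      exact ⟨t, ht, h0.le, h1⟩
    · exact ⟨0, zero_mem_positiveTimes s, le_rfl, by simp [h.crossing_zero]⟩
  · rintro ⟨t, ht, h0, rfl, rfl⟩
    rcases h0.eq_or_lt with rfl | h0
    · right
      rw [neg_zero, h.crossing_zero]
      refine ⟨rfl, rfl, ?_, fun ε hε => ?_⟩
      · rintro ⟨z, hz⟩
        obtain ⟨t, ht', h0, h1, -⟩ := h.exists_of_isLeftReturn ha hz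
        exact (hpos t ht' h0).ne h1
      · have hc : Tendsto (crossing a g s) (𝓝 0) (𝓝 0) := by
          simpa [h.crossing_zero] using
            (h.analyticAt_crossing a (zero_mem_positiveTimes s)).continuousAt.tendsto
        have hc' : Tendsto (fun t => crossing a g s (-t)) (𝓝 0) (𝓝 0) :=
          hc.comp (by simpa using (continuous_neg (G := ℝ)).tendsto 0)
        have hev : ∀ᶠ t in 𝓝[>] (0 : ℝ), t ∈ positiveTimes s ∧ crossing a g s t < ε ∧
            -ε < crossing a g s (-t) ∧ 0 < t := by
          filter_upwards [nhdsWithin_le_nhds (h.isOpen_positiveTimes.mem_nhds ht),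
            nhdsWithin_le_nhds (hc.eventually (gt_mem_nhds hε)),
            nhdsWithin_le_nhds (hc'.eventually (lt_mem_nhds (neg_lt_zero.2 hε))),
            self_mem_nhdsWithin] with t h1 h2 h3 h4
          exact ⟨h1, h2, h3, h4⟩
        obtain ⟨u, h1, h2, h3, h4⟩ := hev.exists
        exact ⟨_, ⟨hpos u h1 h4, h2⟩, _, ⟨h3, hneg u h1 h4⟩, h.isLeftReturn_crossing ha h1 h4⟩
    · exact Or.inl ⟨(hpos t ht h0).le, h.isLeftReturn_crossing ha ht h0⟩

end IsFundamental

theorem leftHalfMap_eq_of_graph {a T D y₀ y₁ : ℝ} (h : LeftHalfMapGraph a T D y₀ y₁) :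
    leftHalfMap a T D y₀ = y₁ := by
  have hex : ∃ y₁, LeftHalfMapGraph a T D y₀ y₁ := ⟨y₁, h⟩
  rw [leftHalfMap, dif_pos hex]
  exact hex.choose_spec.unique h

namespace IsFundamental

variable {T D : ℝ} {g s : ℝ → ℝ} {a : ℝ}

theorem leftDomain_eq (h : IsFundamental T D g s) (ha : 0 < a) :
    leftDomain a T D = positivityInterval a T D ∩ Ici 0 := by
  ext y
  rw [← h.image_crossing ha]
  simp only [leftDomain, mem_ofPred_eq, h.leftHalfMapGraph_iff ha]
  constructor
  · rintro ⟨_, t, ht, h0, rfl, -⟩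
    refine ⟨mem_image_of_mem _ ht, ?_⟩
    simpa [h.crossing_zero] using
      (h.strictMonoOn_crossing ha).monotoneOn (zero_mem_positiveTimes s) ht h0
  · rintro ⟨⟨t, ht, rfl⟩, h0⟩
    refine ⟨_, t, ht, ?_, rfl, rfl⟩
    rw [mem_Ici, ← h.crossing_zero a] at h0
    exact ((h.strictMonoOn_crossing ha).le_iff_le (zero_mem_positiveTimes s) ht).1 h0

theorem leftHalfMap_eqOn (h : IsFundamental T D g s) (ha : 0 < a) :
    EqOn (leftHalfMap a T D) (crossingInvolution a g s) (leftDomain a T D) := by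
  rintro y ⟨z, hz⟩
  rw [leftHalfMap_eq_of_graph hz]
  obtain ⟨t, ht, -, rfl, rfl⟩ := (h.leftHalfMapGraph_iff ha).1 hz
  exact (h.crossingInvolution_crossing ha ht).symm

end IsFundamental

/-! ### The Taylor expansion at `0`. -/

/-- The Taylor polynomial of degree `6` of the half-map at `0`. -/
noncomputable def halfMapTaylor (a T D y : ℝ) : ℝ :=
  -y - 2 * T * y ^ 2 / (3 * a) - 4 * T ^ 2 * y ^ 3 / (9 * a ^ 2)
    + 2 * (9 * D * T - 22 * T ^ 3) * y ^ 4 / (135 * a ^ 3)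
    + 4 * (27 * D * T ^ 2 - 26 * T ^ 4) * y ^ 5 / (405 * a ^ 4)
    - 2 * (27 * D ^ 2 * T - 176 * D * T ^ 3 + 100 * T ^ 5) * y ^ 6 / (945 * a ^ 5)

theorem analyticAt_halfMapTaylor (a T D y : ℝ) : AnalyticAt ℝ (halfMapTaylor a T D) y := by
  unfold halfMapTaylor
  simp only [div_eq_mul_inv]
  fun_prop

theorem deriv_halfMapTaylor (a T D y : ℝ) :
    deriv (halfMapTaylor a T D) y = -1 - 4 * T * y / (3 * a) - 4 * T ^ 2 * y ^ 2 / (3 * a ^ 2)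
      + 8 * (9 * D * T - 22 * T ^ 3) * y ^ 3 / (135 * a ^ 3)
      + 4 * (27 * D * T ^ 2 - 26 * T ^ 4) * y ^ 4 / (81 * a ^ 4)
      - 4 * (27 * D ^ 2 * T - 176 * D * T ^ 3 + 100 * T ^ 5) * y ^ 5 / (315 * a ^ 5) := by
  refine HasDerivAt.deriv ?_
  have hp : ∀ (n : ℕ) (c d : ℝ), HasDerivAt (fun y : ℝ => c * y ^ n / d)
      (c * (n * y ^ (n - 1)) / d) y := fun n c d =>
    ((hasDerivAt_pow n y).const_mul c).div_const d
  refine ((((((hasDerivAt_neg y).sub (hp 2 (2 * T) (3 * a))).sub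
    (hp 3 (4 * T ^ 2) (9 * a ^ 2))).add
    (hp 4 (2 * (9 * D * T - 22 * T ^ 3)) (135 * a ^ 3))).add
    (hp 5 (4 * (27 * D * T ^ 2 - 26 * T ^ 4)) (405 * a ^ 4))).sub
    (hp 6 (2 * (27 * D ^ 2 * T - 176 * D * T ^ 3 + 100 * T ^ 5)) (945 * a ^ 5))).congr_deriv ?_
  push_cast
  ring

/-- The Taylor polynomial solves the equation `φ φ' W(y) = y W(φ)` up to order `7`. -/
theorem halfMapTaylor_ode {a : ℝ} (ha : a ≠ 0) (T D : ℝ) : ∃ R : ℝ → ℝ, Continuous R ∧ ∀ y,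
    halfMapTaylor a T D y * deriv (halfMapTaylor a T D) y * lienardW a T D y -
      y * lienardW a T D (halfMapTaylor a T D y) = y ^ 7 * R y := by
  -- In terms of `b = 1 / a` the Taylor coefficients are polynomial. The witness `R` is the defect
  -- of the equation divided by `y⁷`.
  obtain ⟨b, rfl⟩ : ∃ b, a = b⁻¹ := ⟨a⁻¹, (inv_inv a).symm⟩
  have hb : b ≠ 0 := by simpa using ha
  refine ⟨fun y => (b ^ 2)⁻¹ * (
      (-2368/1575) * b ^ 6 * T ^ 2 * D ^ 2
      + (51712/14175) * b ^ 6 * T ^ 4 * D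
      + (-61184/42525) * b ^ 6 * T ^ 6
      + (2/7) * y * b ^ 7 * T * D ^ 3
      + (-4528/1575) * y * b ^ 7 * T ^ 3 * D ^ 2
      + (15784/4725) * y * b ^ 7 * T ^ 5 * D
      + (-4096/4725) * y * b ^ 7 * T ^ 7
      + (36/175) * y ^ 2 * b ^ 8 * T ^ 2 * D ^ 3
      + (-27952/14175) * y ^ 2 * b ^ 8 * T ^ 4 * D ^ 2
      + (57392/25515) * y ^ 2 * b ^ 8 * T ^ 6 * D
      + (-666304/1148175) * y ^ 2 * b ^ 8 * T ^ 8
      + (176/525) * y ^ 3 * b ^ 9 * T ^ 3 * D ^ 3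
      + (-8464/4725) * y ^ 3 * b ^ 9 * T ^ 5 * D ^ 2
      + (31936/18225) * y ^ 3 * b ^ 9 * T ^ 7 * D
      + (-96832/229635) * y ^ 3 * b ^ 9 * T ^ 9
      + (-152/3675) * y ^ 4 * b ^ 10 * T ^ 2 * D ^ 4
      + (14744/19845) * y ^ 4 * b ^ 10 * T ^ 4 * D ^ 3
      + (-1805008/893025) * y ^ 4 * b ^ 10 * T ^ 6 * D ^ 2
      + (12397984/8037225) * y ^ 4 * b ^ 10 * T ^ 8 * D
      + (-35264/107163) * y ^ 4 * b ^ 10 * T ^ 10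
      + (-192/1225) * y ^ 5 * b ^ 11 * T ^ 3 * D ^ 4
      + (14128/11025) * y ^ 5 * b ^ 11 * T ^ 5 * D ^ 3
      + (-698464/297675) * y ^ 5 * b ^ 11 * T ^ 7 * D ^ 2
      + (5696/3969) * y ^ 5 * b ^ 11 * T ^ 9 * D
      + (-3200/11907) * y ^ 5 * b ^ 11 * T ^ 11
      + (4/245) * y ^ 6 * b ^ 12 * T ^ 2 * D ^ 5
      + (-1408/6615) * y ^ 6 * b ^ 12 * T ^ 4 * D ^ 4
      + (145504/178605) * y ^ 6 * b ^ 12 * T ^ 6 * D ^ 3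
      + (-28160/35721) * y ^ 6 * b ^ 12 * T ^ 8 * D ^ 2
      + (8000/35721) * y ^ 6 * b ^ 12 * T ^ 10 * D
      ), by fun_prop, fun y => ?_⟩
  rw [deriv_halfMapTaylor]
  simp only [halfMapTaylor, lienardW, div_eq_mul_inv, mul_inv, inv_inv, inv_pow]
  field_simp
  ring

/-- A solution of `φ φ' W(y) = y W(φ)` with `φ 0 = 0`, `φ' 0 = -1` is approximated by the
Taylor polynomial. -/
theorem isBigO_sub_halfMapTaylor {a : ℝ} (ha : a ≠ 0) (T D : ℝ) {φ : ℝ → ℝ}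
    (hφ : AnalyticAt ℝ φ 0) (h0 : φ 0 = 0) (h1 : deriv φ 0 = -1)
    (hode : ∀ᶠ y in 𝓝 0, φ y * deriv φ y * lienardW a T D y = y * lienardW a T D (φ y)) :
    (fun y => φ y - halfMapTaylor a T D y) =O[𝓝 0] fun y => y ^ 7 := by
  set q := halfMapTaylor a T D with hq
  have hqa : ∀ y, AnalyticAt ℝ q y := analyticAt_halfMapTaylor a T D
  have hq0 : q 0 = 0 := by simp [hq, halfMapTaylor]
  have hq1 : deriv q 0 = -1 := by simp [hq, deriv_halfMapTaylor]
  by_cases hzero : ∀ᶠ y in 𝓝 (0 : ℝ), φ y - q y = 0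
  · exact (isBigO_zero _ _).congr' (hzero.mono fun y hy => hy.symm) EventuallyEq.rfl
  -- The difference is `y ^ m k(y)` with `k(0) ≠ 0`; the claim is that `m ≥ 7`.
  obtain ⟨m, k, hk, hk0, hkeq⟩ :=
    (hφ.sub (hqa 0)).exists_eventuallyEq_pow_smul_nonzero_iff.2 hzero
  simp only [Pi.sub_apply, sub_zero, smul_eq_mul] at hkeq
  rcases le_or_gt 7 m with hm | hm
  · have e : (fun y => φ y - q y) =ᶠ[𝓝 0] fun y => y ^ 7 * (y ^ (m - 7) * k y) := by
      filter_upwards [hkeq] with y hy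
      rw [hy, ← mul_assoc, ← pow_add, Nat.add_sub_cancel' hm]
    have hc : ContinuousAt (fun y => y ^ (m - 7) * k y) 0 :=
      (continuousAt_id.pow _).mul hk.continuousAt
    simpa using ((isBigO_refl (fun y : ℝ => y ^ 7) (𝓝 0)).mul (hc.isBigO_one ℝ)).congr' e.symm
      (by simp)
  · exfalso
    -- `r y = (φ y + q y) / y`
    set r := dslope (fun y => φ y + q y) 0 with hr
    have hra : AnalyticAt ℝ r 0 := IsFundamental.analyticAt_dslope (hφ.add (hqa 0))
    have hr0 : r 0 = -2 := by
      rw [hr, dslope_same, deriv_fun_add hφ.differentiableAt (hqa 0).differentiableAt, h1, hq1]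
      norm_num
    have hry : ∀ y, φ y + q y = y * r y := fun y => by
      have := sub_smul_dslope (fun y => φ y + q y) 0 y
      simp only [sub_zero, smul_eq_mul, h0, hq0, add_zero] at this
      exact this.symm
    obtain ⟨R, hR, hqode⟩ := halfMapTaylor_ode ha T D
    -- the derivative of `(φ ^ 2 - q ^ 2) / 2 = y ^ (m + 1) k r / 2`
    have hsq : (fun y => φ y ^ 2 - q y ^ 2) =ᶠ[𝓝 0] fun y => y ^ (m + 1) * (k y * r y) := by
      filter_upwards [hkeq] with y hy
      linear_combination (φ y + q y) * hy + y ^ m * k y * hry y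
    -- The difference of the two differential equations, divided by `y ^ m`. If `m < 7`, its limit
    -- at `0` is `-2 (m + 1) k(0) a² = 0`, which is impossible.
    have key : ∀ᶠ y in 𝓝[≠] (0 : ℝ),
        ((m + 1) * (k y * r y) + y * deriv (fun y => k y * r y) y) * lienardW a T D y =
          2 * (y * (k y * (D * (φ y + q y) - a * T))) - 2 * (y ^ (7 - m) * R y) := by
      filter_upwards [nhdsWithin_le_nhds hkeq, nhdsWithin_le_nhds hode,
        nhdsWithin_le_nhds hsq.eventuallyEq_nhds, nhdsWithin_le_nhds hφ.eventually_analyticAt,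
        nhdsWithin_le_nhds (hk.mul hra).eventually_analyticAt, self_mem_nhdsWithin]
        with y hy hyode hysq hyφ hykr hy0
      have hy0' : y ≠ 0 := hy0
      have hd1 := (hyφ.differentiableAt.hasDerivAt.pow 2).sub
        ((hqa y).differentiableAt.hasDerivAt.pow 2)
      have hd2 := (hasDerivAt_pow (m + 1) y).mul hykr.differentiableAt.hasDerivAt
      have hd := hd1.unique (hd2.congr_of_eventuallyEq hysq)
      have hqy := hqode y
      have hpow : y ^ 7 = y ^ m * y ^ (7 - m) := by rw [← pow_add]; congr 1; omega
      rw [hpow] at hqy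
      simp only [Nat.add_sub_cancel, pow_succ, Pi.mul_apply] at hd
      push_cast at hd
      apply mul_left_cancel₀ (pow_ne_zero m hy0')
      simp only [lienardW] at hyode hqy ⊢
      linear_combination -(D * y ^ 2 - a * T * y + a ^ 2) * hd + 2 * hyode - 2 * hqy
        + 2 * y * (D * (φ y + q y) - a * T) * hy
    have hW : Continuous (lienardW a T D) := by unfold lienardW; fun_prop
    have hkr := hk.mul hra
    have l1 := ((((continuousAt_const (y := ((m : ℝ) + 1))).mul hkr.continuousAt).add
      (continuousAt_id.mul hkr.deriv.continuousAt)).mul hW.continuousAt).tendsto.mono_left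
        (nhdsWithin_le_nhds (s := {0}ᶜ))
    have l2 := (((continuousAt_const (y := (2 : ℝ))).mul (continuousAt_id.mul
      (hk.continuousAt.mul (((continuousAt_const (y := D)).mul
        (hφ.continuousAt.add (hqa 0).continuousAt)).sub (continuousAt_const (y := a * T)))))).sub
      ((continuousAt_const (y := (2 : ℝ))).mul
        ((continuousAt_id.pow (7 - m)).mul hR.continuousAt))).tendsto.mono_left
        (nhdsWithin_le_nhds (s := {0}ᶜ))
    have h7 : 7 - m ≠ 0 := by omega
    have hfin := tendsto_nhds_unique (l1.congr' key) l2
    simp [lienardW, hr0, h7, ha, hk0] at hfin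
    exact m.cast_add_one_ne_zero hfin

/-! ### The case `a < 0`: only a center is possible. -/

/-- Along a solution, the inverse integrating factor, which restricts to `W` on the section
`x = 0`, is multiplied by `exp (T t)`. -/
theorem IsLienardSolution.lienardW_eq {a T D : ℝ} {Φ : ℝ → ℝ × ℝ} (hΦ : IsLienardSolution a T D Φ)
    {y₀ y₁ τ : ℝ} (h0 : Φ 0 = (0, y₀)) (hτ : Φ τ = (0, y₁)) :
    lienardW a T D y₁ = Real.exp (T * τ) * lienardW a T D y₀ := by
  have hx : ∀ t, HasDerivAt (fun t => (Φ t).1) (T * (Φ t).1 - (Φ t).2) t := fun t =>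
    (ContinuousLinearMap.fst ℝ ℝ ℝ).hasFDerivAt.comp_hasDerivAt t (hΦ t)
  have hy : ∀ t, HasDerivAt (fun t => (Φ t).2) (D * (Φ t).1 - a) t := fun t =>
    (ContinuousLinearMap.snd ℝ ℝ ℝ).hasFDerivAt.comp_hasDerivAt t (hΦ t)
  have hd : ∀ t, HasDerivAt (fun t => Real.exp (-T * t) * ((D * (Φ t).1 - a) ^ 2 +
      ((Φ t).2 - T * (Φ t).1) * (D * (Φ t).2 - a * T))) 0 t := fun t => by
    refine ((IsFundamental.hasDerivAt_exp (-T) t).mul (((((hx t).const_mul D).sub_const a).pow 2).add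
      (((hy t).sub ((hx t).const_mul T)).mul
        (((hy t).const_mul D).sub_const (a * T))))).congr_deriv ?_
    simp only [Pi.add_apply, Pi.mul_apply, Pi.sub_apply, Pi.pow_apply]
    push_cast
    ring
  have key := is_const_of_deriv_eq_zero (fun t => (hd t).differentiableAt)
    (fun t => (hd t).deriv) τ 0
  have he : Real.exp (T * τ) * Real.exp (-T * τ) = 1 := by rw [← Real.exp_add]; simp
  simp only [h0, hτ, mul_zero, Real.exp_zero] at key
  simp only [lienardW]
  linear_combination Real.exp (T * τ) * key - (D * y₁ ^ 2 - a * T * y₁ + a ^ 2) * he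

/-- If `a < 0` and there are left returns of points arbitrarily close to the origin,
its trace vanishes. -/
theorem trace_eq_zero_of_small_returns {a T D : ℝ} (ha : a < 0)
    (h : ∀ ε > 0, ∃ y₀ ∈ Ico 0 ε, ∃ y₁ ∈ Ioc (-ε) 0, IsLeftReturn a T D y₀ y₁) :
    T = 0 := by
  obtain ⟨g, s, hgs⟩ := exists_isFundamental T D
  obtain ⟨δ, hδ, hball⟩ := Metric.isOpen_iff.1 hgs.isOpen_positiveTimes 0
    (zero_mem_positiveTimes s)
  have hδJ : δ / 2 ∈ positiveTimes s := hball (by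
    rw [Metric.mem_ball, Real.dist_eq, sub_zero, abs_of_pos (half_pos hδ)]
    exact half_lt_self hδ)
  -- Before `δ / 2` both `g` and `s` are positive, so `a g - y₀ s < 0` and no return can occur.
  have hτ : ∀ y₀ y₁, 0 ≤ y₀ → IsLeftReturn a T D y₀ y₁ →
      ∃ τ, δ / 2 ≤ τ ∧ lienardW a T D y₁ = Real.exp (T * τ) * lienardW a T D y₀ := by
    rintro y₀ y₁ hy₀ ⟨Φ, hΦ, h0, τ, hτ, h1, -⟩
    refine ⟨τ, ?_, hΦ.lienardW_eq h0 h1⟩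
    by_contra! hlt
    have hτJ : τ ∈ positiveTimes s := positiveTimes_mono hδJ (by
      rw [abs_of_pos hτ, abs_of_pos (half_pos hδ)]; exact hlt.le)
    have h2 := congrArg Prod.fst (h1.symm.trans (hgs.eq_of_isLienardSolution hΦ h0 τ))
    simp only at h2
    have h3 := IsFundamental.s_pos hτJ hτ
    have h4 := hgs.g_pos hτJ hτ.ne'
    nlinarith [mul_nonneg hy₀ h3.le, mul_pos (neg_pos.2 ha) h4]
  choose! y₀ hy₀ y₁ hy₁ hret using h
  have hl : ∀ f : ℝ → ℝ, (∀ ε > 0, |f ε| ≤ ε) →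
      Tendsto (fun ε => lienardW a T D (f ε)) (𝓝[>] 0) (𝓝 (a ^ 2)) := fun f hf => by
    have hc : Continuous (lienardW a T D) := by unfold lienardW; fun_prop
    have h1 : Tendsto f (𝓝[>] 0) (𝓝 0) := by
      refine squeeze_zero_norm' ?_ (tendsto_id.mono_left nhdsWithin_le_nhds)
      filter_upwards [self_mem_nhdsWithin] with ε hε using hf ε hε
    have h2 := (hc.tendsto 0).comp h1
    simpa only [lienardW, Function.comp_def, ne_eq, OfNat.ofNat_ne_zero, not_false_eq_true,
      zero_pow, mul_zero, sub_zero, zero_add] using h2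
  have l0 := hl y₀ fun ε hε => by
    rw [abs_of_nonneg (hy₀ ε hε).1]; exact (hy₀ ε hε).2.le
  have l1 := hl y₁ fun ε hε => by
    rw [abs_of_nonpos (hy₁ ε hε).2]; linarith [(hy₁ ε hε).1]
  have ha2 : 0 < a ^ 2 := by have := ha.ne; positivity
  have hpos := l0.eventually (lt_mem_nhds ha2)
  -- If `T ≠ 0`, the factor `exp (T τ)` stays on one side of `exp (T δ / 2) ≠ 1`, although `W(y₀)`
  -- and `W(y₁)` have the same limit `a²`.
  rcases lt_trichotomy T 0 with hT | hT | hT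
  · exfalso
    have hle : a ^ 2 ≤ Real.exp (T * (δ / 2)) * a ^ 2 := by
      refine le_of_tendsto_of_tendsto l1 (l0.const_mul _) ?_
      filter_upwards [hpos, self_mem_nhdsWithin] with ε hp hε
      obtain ⟨τ, h1, h2⟩ := hτ _ _ (hy₀ ε hε).1 (hret ε hε)
      rw [h2]
      exact mul_le_mul_of_nonneg_right (Real.exp_le_exp.2
        (mul_le_mul_of_nonpos_left h1 hT.le)) hp.le
    have : Real.exp (T * (δ / 2)) < 1 := by
      rw [Real.exp_lt_one_iff]
      exact mul_neg_of_neg_of_pos hT (half_pos hδ)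
    nlinarith
  · exact hT
  · exfalso
    have hle : Real.exp (T * (δ / 2)) * a ^ 2 ≤ a ^ 2 := by
      refine le_of_tendsto_of_tendsto (l0.const_mul _) l1 ?_
      filter_upwards [hpos, self_mem_nhdsWithin] with ε hp hε
      obtain ⟨τ, h1, h2⟩ := hτ _ _ (hy₀ ε hε).1 (hret ε hε)
      rw [h2]
      exact mul_le_mul_of_nonneg_right (Real.exp_le_exp.2
        (mul_le_mul_of_nonneg_left h1 hT.le)) hp.le
    have : 1 < Real.exp (T * (δ / 2)) := Real.one_lt_exp_iff.2 (mul_pos hT (half_pos hδ))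
    nlinarith

/-- For `D ≤ 0` one has `y' = D x - a > 0` on `x < 0`, so `y` could not go from `y₀ ≥ 0` to `y₁ ≤
0`. -/
theorem det_pos_of_isLeftReturn {a T D y₀ y₁ : ℝ} (ha : a < 0) (h₀ : 0 ≤ y₀) (h₁ : y₁ ≤ 0)
    (h : IsLeftReturn a T D y₀ y₁) : 0 < D := by
  obtain ⟨Φ, hΦ, h0, τ, hτ, h1, hneg⟩ := h
  by_contra! hD
  have hy : ∀ t, HasDerivAt (fun t => (Φ t).2) (D * (Φ t).1 - a) t := fun t =>
    (ContinuousLinearMap.snd ℝ ℝ ℝ).hasFDerivAt.comp_hasDerivAt t (hΦ t)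
  have hmono : StrictMonoOn (fun t => (Φ t).2) (Icc 0 τ) := by
    refine strictMonoOn_of_deriv_pos (convex_Icc 0 τ)
      (fun t _ => (hy t).continuousAt.continuousWithinAt) fun t ht => ?_
    rw [interior_Icc] at ht
    rw [(hy t).deriv]
    nlinarith [mul_nonneg_of_nonpos_of_nonpos hD (hneg t ht).le]
  have := hmono (left_mem_Icc.2 hτ.le) (right_mem_Icc.2 hτ.le) hτ
  simp only [h0, h1] at this
  linarith

/-- The left returns of a center in the half-plane `x < 0`. -/
theorem isLeftReturn_center {a D y : ℝ} (ha : a < 0) (hD : 0 < D) (hy : 0 ≤ y) :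
    IsLeftReturn a 0 D y (-y) := by
  have ha0 : a ≠ 0 := ha.ne
  obtain ⟨ω, hω, rfl⟩ : ∃ ω > 0, D = ω ^ 2 :=
    ⟨√D, Real.sqrt_pos.2 hD, (Real.sq_sqrt hD.le).symm⟩
  -- `β` is the initial phase on the ellipse around the equilibrium `(a / ω², 0)`; the orbit is back
  -- on the section at phase `2π - β`.
  set β := Real.arctan (y * ω / -a) with hβ
  have hβ0 : 0 ≤ β := Real.arctan_nonneg.2 (div_nonneg (mul_nonneg hy hω.le) (by linarith))
  have hβ2 : β < Real.pi / 2 := Real.arctan_lt_pi_div_two _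
  have hcos : 0 < Real.cos β := Real.cos_arctan_pos _
  have hsin : Real.sin β = y * ω / -a * Real.cos β := by
    rw [← Real.tan_mul_cos hcos.ne', hβ, Real.tan_arctan]
  have hc1 : ∀ t, HasDerivAt (fun t => Real.cos (ω * t + β)) (-Real.sin (ω * t + β) * ω) t :=
    fun t => by
      simpa using ((((hasDerivAt_id t).const_mul ω).add_const β).cos)
  have hs1 : ∀ t, HasDerivAt (fun t => Real.sin (ω * t + β)) (Real.cos (ω * t + β) * ω) t :=
    fun t => by
      simpa using ((((hasDerivAt_id t).const_mul ω).add_const β).sin)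
  refine ⟨fun t => (a / (ω ^ 2 * Real.cos β) * (Real.cos β - Real.cos (ω * t + β)),
    -(a / (ω * Real.cos β) * Real.sin (ω * t + β))), fun t => ?_, ?_,
    2 * (Real.pi - β) / ω, ?_, ?_, fun t ht => ?_⟩
  · refine ((((hc1 t).const_sub (Real.cos β)).const_mul _).prodMk
      (((hs1 t).const_mul _).neg)).congr_deriv ?_
    simp only [lienardField, Prod.mk.injEq]
    constructor <;> field_simp <;> ring
  · simp only [mul_zero, zero_add, sub_self, Prod.mk.injEq, true_and, hsin]
    field_simp
  · exact div_pos (by linarith) hω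
  · have e : ω * (2 * (Real.pi - β) / ω) + β = 2 * Real.pi - β := by field_simp; ring
    simp only [e, Real.cos_two_pi_sub, Real.sin_two_pi_sub, sub_self, mul_zero, Prod.mk.injEq,
      true_and, hsin]
    field_simp
  · have e : Real.cos β - Real.cos (ω * t + β) =
        2 * (Real.sin (ω * t / 2 + β) * Real.sin (ω * t / 2)) := by
      rw [Real.cos_sub_cos, show (β - (ω * t + β)) / 2 = -(ω * t / 2) by ring,
        show (β + (ω * t + β)) / 2 = ω * t / 2 + β by ring, Real.sin_neg]
      ring
    have h1 : 0 < ω * t / 2 := by have := mul_pos hω ht.1; linarith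
    have h2 : ω * t / 2 < Real.pi - β := by
      have := (lt_div_iff₀ hω).1 ht.2
      linarith
    have h3 := Real.sin_pos_of_pos_of_lt_pi h1 (by linarith)
    have h4 := Real.sin_pos_of_pos_of_lt_pi (x := ω * t / 2 + β) (by linarith) (by linarith)
    simp only [e]
    exact mul_neg_of_neg_of_pos (div_neg_of_neg_of_pos ha (by positivity)) (by positivity)

theorem positivityInterval_center {a D : ℝ} (ha : a ≠ 0) (hD : 0 < D) :
    positivityInterval a 0 D = univ := by
  have : {y | 0 < lienardW a 0 D y} = univ := by
    refine eq_univ_of_forall fun y => ?_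
    simp only [mem_ofPred_eq, lienardW, mul_zero, zero_mul, sub_zero]
    positivity
  rw [positivityInterval, this, connectedComponentIn_univ, PreconnectedSpace.connectedComponent_eq_univ]

theorem leftDomain_center {a D : ℝ} (ha : a < 0) (hD : 0 < D) : leftDomain a 0 D = Ici 0 := by
  ext y
  constructor
  · rintro ⟨z, ⟨hy, -⟩ | ⟨rfl, -⟩⟩
    · exact hy
    · exact self_mem_Ici
  · exact fun hy => ⟨-y, Or.inl ⟨hy, isLeftReturn_center ha hD hy⟩⟩

theorem trace_eq_zero_and_det_pos {a T D : ℝ} (ha : a < 0) (h : LeftHalfMapGraph a T D 0 0) :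
    T = 0 ∧ 0 < D := by
  have h' : ∀ ε > 0, ∃ y₀ ∈ Ico 0 ε, ∃ y₁ ∈ Ioc (-ε) 0, IsLeftReturn a T D y₀ y₁ := by
    intro ε hε
    -- A genuine return from `0` to `0` serves for every `ε`.
    rcases h with ⟨-, h⟩ | ⟨-, -, -, h⟩
    · exact ⟨0, left_mem_Ico.2 hε, 0, right_mem_Ioc.2 (neg_lt_zero.2 hε), h⟩
    · obtain ⟨z₀, h0, z₁, h1, hz⟩ := h ε hε
      exact ⟨z₀, Ioo_subset_Ico_self h0, z₁, Ioo_subset_Ioc_self h1, hz⟩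
  refine ⟨trace_eq_zero_of_small_returns ha h', ?_⟩
  obtain ⟨y₀, h0, y₁, h1, hr⟩ := h' 1 one_pos
  exact det_pos_of_isLeftReturn ha h0.1 h1.2 hr

/-! ### Assembly of the two cases. -/

theorem proposition1 (a T D : ℝ) (ha : a ≠ 0) (h0 : (0 : ℝ) ∈ leftDomain a T D)
    (hP : leftHalfMap a T D 0 = 0) :
    AnalyticOn ℝ (leftHalfMap a T D) (leftDomain a T D) ∧
    (∃ φ : ℝ → ℝ,
      AnalyticOnNhd ℝ φ (positivityInterval a T D) ∧
      MapsTo φ (positivityInterval a T D) (positivityInterval a T D) ∧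
      (∀ y ∈ positivityInterval a T D, φ (φ y) = y) ∧
      leftDomain a T D = positivityInterval a T D ∩ Ici 0 ∧
      EqOn (leftHalfMap a T D) φ (leftDomain a T D)) ∧
    (fun y₀ : ℝ => leftHalfMap a T D y₀ -
        (-y₀ - 2 * T * y₀ ^ 2 / (3 * a) - 4 * T ^ 2 * y₀ ^ 3 / (9 * a ^ 2)
          + 2 * (9 * D * T - 22 * T ^ 3) * y₀ ^ 4 / (135 * a ^ 3)
          + 4 * (27 * D * T ^ 2 - 26 * T ^ 4) * y₀ ^ 5 / (405 * a ^ 4)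
          - 2 * (27 * D ^ 2 * T - 176 * D * T ^ 3 + 100 * T ^ 5) * y₀ ^ 6 / (945 * a ^ 5)))
      =O[𝓝[≥] 0] (fun y₀ : ℝ => y₀ ^ 7) := by
  rcases ha.lt_or_gt with hneg | hpos
  · have hgraph : LeftHalfMapGraph a T D 0 0 := by
      obtain ⟨z, hz⟩ := h0
      have := leftHalfMap_eq_of_graph hz
      rwa [← this, hP] at hz
    obtain ⟨rfl, hD⟩ := trace_eq_zero_and_det_pos hneg hgraph
    have hmap : EqOn (leftHalfMap a 0 D) (fun y => -y) (Ici 0) := fun y hy =>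
      leftHalfMap_eq_of_graph (Or.inl ⟨hy, isLeftReturn_center hneg hD hy⟩)
    rw [leftDomain_center hneg hD, positivityInterval_center ha hD]
    have han : AnalyticOnNhd ℝ (fun y : ℝ => -y) univ := fun y _ => analyticAt_id.neg
    refine ⟨(han.analyticOn.mono (subset_univ _)).congr hmap,
      ⟨fun y => -y, han, mapsTo_univ _ _, fun y _ => neg_neg y, by simp, hmap⟩, ?_⟩
    -- Every term of the expansion beyond `-y₀` has a factor `T`, so the error is exactly `0`.
    refine (isBigO_zero _ _).congr' ?_ EventuallyEq.rfl
    filter_upwards [self_mem_nhdsWithin] with y hy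
    rw [hmap hy]
    simp
  · obtain ⟨g, s, h⟩ := exists_isFundamental T D
    have han := h.analyticOnNhd_crossingInvolution hpos
    have hdom := h.leftDomain_eq hpos
    have heq := h.leftHalfMap_eqOn hpos
    refine ⟨(han.analyticOn.mono (hdom ▸ inter_subset_left)).congr heq,
      ⟨_, han, h.mapsTo_crossingInvolution hpos, h.crossingInvolution_involutive hpos, hdom, heq⟩,
      ?_⟩
    -- `Y` is open at `0` because `Y'(0) ≠ 0`.
    have hnhds : positivityInterval a T D ∈ 𝓝 (0 : ℝ) := by
      rw [← h.image_crossing hpos]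
      have hY := h.analyticAt_crossing a (zero_mem_positiveTimes s)
      have hmap := hY.hasStrictDerivAt.map_nhds_eq
        (h.deriv_crossing_pos hpos (zero_mem_positiveTimes s)).ne'
      rw [h.crossing_zero] at hmap
      rw [← hmap]
      exact image_mem_map (h.isOpen_positiveTimes.mem_nhds (zero_mem_positiveTimes s))
    have hO := (isBigO_sub_halfMapTaylor ha T D (han 0 (h.zero_mem_positivityInterval hpos))
      (h.crossingInvolution_zero hpos) (h.deriv_crossingInvolution_zero hpos)
      (by filter_upwards [hnhds] with y hy using h.crossingInvolution_ode hpos hy)).mono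
        (nhdsWithin_le_nhds (s := Ici 0))
    refine hO.congr' ?_ EventuallyEq.rfl
    filter_upwards [nhdsWithin_le_nhds hnhds, self_mem_nhdsWithin] with y hy hy0
    rw [heq (hdom ▸ ⟨hy, hy0⟩)]
    rfl
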